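/- \textbf{Setting.} Let $\Lambda\ge 1$, let $K_0,\dots,K_\Lambda$ be non-negative integers, and let $N\ge K:=\sum_{\lambda=0}^{\Lambda}K_\lambda\binom{\Lambda}{\lambda}$. A server holds $N$ files of $B$ bits each. There are $\Lambda$ caches, each able to store $MB$ bits, and $K$ users. In the generalized combinatorial topology, for every $\lambda\in\{0,\dots,\Lambda\}$ and every set $\mathcal U$ of $\lambda$ caches, exactly $K_\lambda$ users are connected to precisely the caches in $\mathcal U$. A user reads without cost the content of all caches it is connected to. In the placement phase, before the demands are known, each cache stores an uncoded copy of at most $MB$ of the $NB$ library bits. Then each user requests one file, and the server, knowing all requests, broadcasts $L$ bits to all users over an error-free link. Every user must recover its requested file, for every library content, from the broadcast and from the caches it is connected to. A pair $(M,R)$ is achievable under uncoded placement if, for some file size $B\ge 1$, there is such a placement for which every demand vector can be served with $L\le RB$ broadcast bits. Let $R^\star_{\mathrm{comb}}(M)=\inf\{R: (M,R)\text{ is achievable under uncoded placement}\}$ be the optimal worst-case load. \textbf{Theorem.} For every $t\in\{0,1,\dots,\Lambda\}$, $$R^\star_{\mathrm{comb}}\!\left(t\,\frac{N}{\Lambda}\right)=f(t):=\sum_{\lambda=0}^{\Lambda-t}K_\lambda\,\frac{\binom{\Lambda}{t+\lambda}}{\binom{\Lambda}{t}},$$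 and between two consecutive such points $R^\star_{\mathrm{comb}}$ is linear: for every $t\in\{0,\dots,\Lambda-1\}$ and every $\theta\in[0,1]$, $$R^\star_{\mathrm{comb}}\!\left((t+\theta)\,\frac{N}{\Lambda}\right)=(1-\theta)f(t)+\theta f(t+1).$$ That is, on $[0,N]$ the optimal worst-case load is exactly the piecewise-linear curve with corner points $\left(tN/\Lambda,\,f(t)\right)$, $t\in\{0,\dots,\Lambda\}$. -/

import Mathlib

namespace MACC

/-- A connectivity with `Λ` caches: `b U` is the number of users connected exactly to the caches
in `U` (and to no other cache). -/
abbrev Connectivity (Λ : ℕ) := Finset (Fin Λ) → ℕ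

/-- The users of a connectivity: the pair `⟨U, k⟩` is the `k`-th user connected exactly to `U`. -/
abbrev User {Λ : ℕ} (b : Connectivity Λ) := Σ U : Finset (Fin Λ), Fin (b U)

/-- The generalized combinatorial topology: every set of `s` caches is the exact cache set of
`K s` users, for every `s` (only `K 0, …, K Λ` matter). -/
def combTopology (Λ : ℕ) (K : ℕ → ℕ) : Connectivity Λ := fun U => K U.card

/-- A library of `N` files of `B` bits each. -/
abbrev Library (N B : ℕ) := Fin N → Fin B → Bool

/-- An uncoded placement: every cache stores a copy of the library bits whose positions
(file, position inside the file) belong to a set chosen in advance. -/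
abbrev Placement (Λ N B : ℕ) := Fin Λ → Finset (Fin N × Fin B)

/-- What a user connected to the caches in `U` reads from them. -/
def cacheContent {Λ N B : ℕ} (Z : Placement Λ N B) (W : Library N B) (U : Finset (Fin Λ)) :
    (ℓ : {ℓ // ℓ ∈ U}) → {p // p ∈ Z ℓ.1} → Bool :=
  fun _ p => W p.1.1 p.1.2

/-- With placement `Z`, the demand `d` can be served by a broadcast of `L` bits: there are an
encoder at the server and a decoder for every user such that, for every library content, every
user recovers its requested file from the broadcast and from the caches it is connected to. -/
def Deliverable {Λ N B : ℕ} (b : Connectivity Λ) (Z : Placement Λ N B) (d : User b → Fin N)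
    (L : ℕ) : Prop :=
  ∃ (enc : Library N B → (Fin L → Bool))
    (dec : (u : User b) → (Fin L → Bool) →
      ((ℓ : {ℓ // ℓ ∈ u.1}) → {p // p ∈ Z ℓ.1} → Bool) → (Fin B → Bool)),
    ∀ (W : Library N B) (u : User b), dec u (enc W) (cacheContent Z W u.1) = W (d u)

/-- `(M, R)` is achievable with uncoded placement: for some file size `B` there is a placement,
chosen before the demand is known, that uses at most `M * B` bits in each cache and allows every
demand to be served with at most `R * B` broadcast bits. -/
def Achievable {Λ : ℕ} (b : Connectivity Λ) (N : ℕ) (M R : ℝ) : Prop :=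
  ∃ B : ℕ, 0 < B ∧ ∃ Z : Placement Λ N B,
    (∀ ℓ, ((Z ℓ).card : ℝ) ≤ M * B) ∧
      ∀ d : User b → Fin N, ∃ L : ℕ, (L : ℝ) ≤ R * B ∧ Deliverable b Z d L

/-- The optimal worst-case load under uncoded placement, as a function of the cache size `M`. -/
noncomputable def optimalLoad {Λ : ℕ} (b : Connectivity Λ) (N : ℕ) (M : ℝ) : ℝ :=
  sInf {R : ℝ | Achievable b N M R}

/-- For `0 ≤ M` and at least one file per user, `optimalLoad` is a genuine infimum. -/
theorem isGLB_optimalLoad {Λ : ℕ} (b : Connectivity Λ) (N : ℕ) (M : ℝ) (hM : 0 ≤ M)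
    (hN : Fintype.card (User b) ≤ N) :
    IsGLB {R : ℝ | Achievable b N M R} (optimalLoad b N M) := by
  apply Real.isGLB_sInf
  · refine ⟨N, 1, one_pos, fun _ => ∅, fun _ => by simpa using hM, fun d => ⟨N, by simp, ?_⟩⟩
    exact ⟨fun W n => W n 0, fun u x _ _ => x (d u), fun W u => by
      funext i; rw [Subsingleton.elim i 0]⟩
  · refine ⟨0, ?_⟩
    rintro R ⟨B, hB, Z, -, h⟩
    let e : User b → Fin N := fun u =>
      Fin.castLE hN ((Fintype.equivFin (User b)) u)
    obtain ⟨L, hL, -⟩ := h e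
    have hB' : (0 : ℝ) < B := by exact_mod_cast hB
    exact nonneg_of_mul_nonneg_left ((Nat.cast_nonneg L).trans hL) hB'

/-- The load at the corner point with cache size `t * N / Λ`. -/
noncomputable def cornerLoad (Λ : ℕ) (K : ℕ → ℕ) (t : ℕ) : ℝ :=
  ∑ s ∈ Finset.range (Λ - t + 1), (K s : ℝ) * ((Λ.choose (t + s) : ℝ) / (Λ.choose t : ℝ))

end MACC

/-!
Upper bound. Cut every file into layers; a layer of level `r` consists of one bit for each set of
`r` caches, stored exactly in these caches. For a layer of level `t` and users with `s` caches each,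
the server sends, for every set `S` of `t + s` caches, the exclusive or over `U ⊆ S`, `U.card = s`,
of the requested bit stored in `S \ U` (`multicast`). The user of `U` recovers its bit because every
other `U'` misses a cache of `U`, so that `S \ U'` meets `U` (`multicast_separates`). This gives
`Λ.choose (t + s)` messages for `Λ.choose t` bits and each of the `K s` users per set, that is the
load `cornerLoad Λ K t`. Mixing layers of levels `t` and `t + 1` reaches every rational point of the
segment between two corners (`achievable_rational`), and irrational points follow in the limit.

Lower bound. Fix distinct demands and an order of the caches. If users decode in the order of their
last cache, then the bits requested by a user and stored only in caches after its last one are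
independent given all that was read before, so their number is at most the length of the broadcast
(`sum_card_le_of_deliverable`). Sum this over the cyclic shifts of the demand, in which every user
requests every file once, and over all orders of the caches. A set of `t + s` caches splits in one
way into `s` caches followed by `t` caches, so a bit stored in `t` caches contributes on average
at least `cornerLoad Λ K t` (`cornerLoad_le_sum_perm`). Since `cornerLoad` is nonincreasing and convex in `t`
(`cornerLoad_antitone`, `cornerLoad_convex`), each of its values is bounded below by the line
through two consecutive corners, and the constraint on the total cache size gives the bound
(`le_of_achievable`).
-/

namespace MACC

open Filter Topology

/-! ### The coded multicast scheme -/

/-- Decoders may be replaced by a separation property: a broadcast serves the demand as soon as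
two libraries with the same broadcast and the same contents of the caches seen by a user agree on
the file that this user requests. -/
theorem deliverable_of_separates {Λ N B : ℕ} {b : Connectivity Λ} {Z : Placement Λ N B}
    {d : User b → Fin N} {J : Type*} [Fintype J] (enc : Library N B → J → Bool)
    (h : ∀ (u : User b) (W W' : Library N B), enc W = enc W' →
      (∀ ℓ ∈ u.1, ∀ p ∈ Z ℓ, W p.1 p.2 = W' p.1 p.2) → W (d u) = W' (d u)) :
    Deliverable b Z d (Fintype.card J) := by
  classical
  let e := Fintype.equivFin J
  refine ⟨fun W x => enc W (e.symm x), fun u x c =>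
    if hx : ∃ W : Library N B, (fun y => enc W (e.symm y)) = x ∧ cacheContent Z W u.1 = c
    then hx.choose (d u) else fun _ => false, fun W u => ?_⟩
  have hx : ∃ W' : Library N B, (fun y => enc W' (e.symm y)) = (fun y => enc W (e.symm y)) ∧
      cacheContent Z W' u.1 = cacheContent Z W u.1 := ⟨W, rfl, rfl⟩
  simp only [dif_pos hx]
  obtain ⟨h1, h2⟩ := hx.choose_spec
  refine h u _ _ (funext fun j => ?_) fun ℓ hℓ p hp => ?_
  · simpa using congrFun h1 (e j)
  · exact congrFun (congrFun h2 ⟨ℓ, hℓ⟩) ⟨p, hp⟩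

/-- The subfiles of a file that is cut into equal layers, one for each `a : ι`: layer `a` is split
into one bit for each set of `lev a` caches, and that bit is stored exactly in these caches.
Layers of different levels realise memory sharing. -/
abbrev Subfile (Λ : ℕ) {ι : Type} (lev : ι → ℕ) : Type :=
  Σ a : ι, {T : Finset (Fin Λ) // T.card = lev a}

/-- The indices of the multicast messages: a layer `a`, a number `s` of caches per user, a set `S`
of `lev a + s` caches and an index `k` of a user within each cache set of size `s`. -/
abbrev Multicast (Λ : ℕ) (K : ℕ → ℕ) {ι : Type} (lev : ι → ℕ) : Type :=
  Σ a : ι, Σ s : Fin (Λ + 1), {S : Finset (Fin Λ) // S.card = lev a + s} × Fin (K s)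

/-- Bits as elements of the field with two elements, in which exclusive or is addition. -/
def bitEquiv : ZMod 2 ≃ Bool := finTwoEquiv

/-- The multicast message `(a, s, S, k)`: the exclusive or, over the cache sets `U ⊆ S` of size
`s`, of the bit of layer `a` that is stored exactly in `S \ U`, taken from the file requested by the
`k`-th user of `U`. -/
def multicast {Λ N : ℕ} {K : ℕ → ℕ} {ι : Type} {lev : ι → ℕ}
    (d : User (combTopology Λ K) → Fin N) (W : Fin N → Subfile Λ lev → Bool) :
    Multicast Λ K lev → Bool := fun x =>
  bitEquiv (∑ U : {U : Finset (Fin Λ) // U ⊆ x.2.2.1.1 ∧ U.card = x.2.1},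
    bitEquiv.symm (W
      (d ⟨U.1, Fin.cast (show K x.2.1 = K U.1.card by rw [U.2.2]) x.2.2.2⟩)
      ⟨x.1, x.2.2.1.1 \ U.1, by
        rw [Finset.card_sdiff_of_subset U.2.1, x.2.2.1.2, U.2.2, Nat.add_sub_cancel]⟩))

theorem multicast_separates {Λ N : ℕ} {K : ℕ → ℕ} {ι : Type} {lev : ι → ℕ}
    (d : User (combTopology Λ K) → Fin N) (W W' : Fin N → Subfile Λ lev → Bool)
    (u : User (combTopology Λ K)) (henc : multicast d W = multicast d W')
    (hcache : ∀ ℓ ∈ u.1, ∀ n, ∀ i : Subfile Λ lev, ℓ ∈ i.2.1 → W n i = W' n i) :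
    W (d u) = W' (d u) := by
  classical
  obtain ⟨U, k⟩ := u
  funext ⟨a, T, hT⟩
  by_cases hUT : Disjoint T U
  swap
  · obtain ⟨ℓ, h1, h2⟩ := Finset.not_disjoint_iff.1 hUT
    exact hcache ℓ h2 _ _ h1
  have hU : U.card < Λ + 1 := Nat.lt_succ_of_le (by simpa using Finset.card_le_univ U)
  have hS : (T ∪ U).card = lev a + U.card := by rw [Finset.card_union_of_disjoint hUT, hT]
  have hm := congrFun henc ⟨a, ⟨U.card, hU⟩, ⟨T ∪ U, hS⟩, k⟩
  have hm' := bitEquiv.injective hm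
  have hmem : U ⊆ T ∪ U ∧ U.card = U.card := ⟨Finset.subset_union_right, rfl⟩
  rw [← Finset.add_sum_erase _ _ (Finset.mem_univ ⟨U, hmem⟩),
    ← Finset.add_sum_erase _ _ (Finset.mem_univ ⟨U, hmem⟩)] at hm'
  -- Any other `V ⊆ T ∪ U` of the size of `U` misses a cache of `U`, so the user of `U` has read the
  -- bit stored in `(T ∪ U) \ V`.
  rw [Finset.sum_congr (g := fun V : {V : Finset (Fin Λ) // V ⊆ T ∪ U ∧ V.card = U.card} =>
    bitEquiv.symm (W' (d ⟨V.1, Fin.cast (show K U.card = K V.1.card by rw [V.2.2]) k⟩)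
      ⟨a, (T ∪ U) \ V.1, by
        rw [Finset.card_sdiff_of_subset V.2.1, hS, V.2.2, Nat.add_sub_cancel]⟩)) rfl] at hm'
  · have h1 := bitEquiv.symm.injective (add_right_cancel hm')
    have h2 : (⟨a, (T ∪ U) \ U, by
        rw [Finset.card_sdiff_of_subset hmem.1, hS, Nat.add_sub_cancel]⟩ : Subfile Λ lev) =
        ⟨a, T, hT⟩ := by
      congr 2
      rw [Finset.union_sdiff_right, Finset.sdiff_eq_self_of_disjoint hUT]
    rw [← h2]
    exact h1
  · intro V hV
    have hne : V.1 ≠ U := fun h => (Finset.mem_erase.1 hV).1 (Subtype.ext h)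
    have hsub : ¬ U ⊆ V.1 := fun h => hne (Finset.eq_of_subset_of_card_le h V.2.2.le).symm
    obtain ⟨ℓ, h1, h2⟩ := Finset.not_subset.1 hsub
    congr 1
    exact hcache ℓ h1 _ _ (Finset.mem_sdiff.2 ⟨Finset.mem_union_right _ h1, h2⟩)

theorem card_subfile (Λ : ℕ) {ι : Type} [Fintype ι] (lev : ι → ℕ) :
    Fintype.card (Subfile Λ lev) = ∑ a, Λ.choose (lev a) := by
  simp [Fintype.card_sigma]

/-- A cache is one of the `r` caches of a set of size `r` in a fraction `r / Λ` of the cases. -/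
theorem card_filter_mem_mul (Λ r : ℕ) (ℓ : Fin Λ) :
    Fintype.card {T : {T : Finset (Fin Λ) // T.card = r} // ℓ ∈ T.1} * Λ = r * Λ.choose r := by
  classical
  obtain ⟨n, rfl⟩ : ∃ n, Λ = n + 1 := ⟨Λ - 1, by have := ℓ.pos; omega⟩
  have h1 : Fintype.card {T : {T : Finset (Fin (n + 1)) // T.card = r} // ℓ ∈ T.1} +
      n.choose r = (n + 1).choose r := by
    have e2 : Fintype.card {T : {T : Finset (Fin (n + 1)) // T.card = r} // ¬ ℓ ∈ T.1} =
        n.choose r := by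
      have : n.choose r = ((Finset.univ.erase ℓ).powersetCard r).card := by simp
      have hmem : ∀ T : Finset (Fin (n + 1)),
          T ∈ (Finset.univ.erase ℓ).powersetCard r ↔ T.card = r ∧ ℓ ∉ T := by
        intro T
        rw [Finset.mem_powersetCard, Finset.subset_erase]
        simp [and_comm]
      rw [this, ← Fintype.card_coe]
      exact Fintype.card_congr
        { toFun := fun T => ⟨T.1.1, (hmem _).2 ⟨T.1.2, T.2⟩⟩
          invFun := fun T => ⟨⟨T.1, ((hmem _).1 T.2).1⟩, ((hmem _).1 T.2).2⟩
          left_inv := fun _ => rfl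
          right_inv := fun _ => rfl }
    have h3 := Fintype.card_subtype_compl
      (fun T : {T : Finset (Fin (n + 1)) // T.card = r} => ℓ ∈ T.1)
    have h4 := Fintype.card_subtype_le
      (fun T : {T : Finset (Fin (n + 1)) // T.card = r} => ℓ ∈ T.1)
    have h5 : Fintype.card {T : Finset (Fin (n + 1)) // T.card = r} = (n + 1).choose r := by simp
    rw [e2] at h3
    omega
  have h2 := Nat.choose_mul_succ_eq n r
  rcases le_or_gt r (n + 1) with hr | hr
  · obtain ⟨m, hm⟩ := Nat.exists_eq_add_of_le hr
    have hm' : n + 1 - r = m := by omega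
    rw [hm'] at h2
    have : (Fintype.card {T : {T : Finset (Fin (n + 1)) // T.card = r} // ℓ ∈ T.1} +
      n.choose r) * (n + 1) = (n + 1).choose r * (r + m) := by rw [h1, ← hm]
    nlinarith
  · have h0 : (n + 1).choose r = 0 := Nat.choose_eq_zero_of_lt hr
    rw [h0] at h1 ⊢
    simp [(Nat.add_eq_zero_iff.1 h1).1]

/-- Storing each subfile in its caches takes a fraction `lev a / Λ` of layer `a`. -/
theorem card_cached_mul (Λ : ℕ) {ι : Type} [Fintype ι] (lev : ι → ℕ) (ℓ : Fin Λ) :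
    Fintype.card {i : Subfile Λ lev // ℓ ∈ i.2.1} * Λ = ∑ a, lev a * Λ.choose (lev a) := by
  classical
  let e : {i : Subfile Λ lev // ℓ ∈ i.2.1} ≃
      Σ a : ι, {T : {T : Finset (Fin Λ) // T.card = lev a} // ℓ ∈ T.1} :=
    { toFun := fun i => ⟨i.1.1, i.1.2, i.2⟩
      invFun := fun i => ⟨⟨i.1, i.2.1⟩, i.2.2⟩
      left_inv := fun _ => rfl
      right_inv := fun _ => rfl }
  rw [Fintype.card_congr e, Fintype.card_sigma, Finset.sum_mul]
  exact Finset.sum_congr rfl fun a _ => card_filter_mem_mul Λ (lev a) ℓ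

/-- `cornerLoad` with a range of summation independent of `t`. -/
theorem cornerLoad_eq_sum (Λ : ℕ) (K : ℕ → ℕ) (t : ℕ) :
    cornerLoad Λ K t = ∑ s ∈ Finset.range (Λ + 1),
      (K s : ℝ) * ((Λ.choose (t + s) : ℝ) / (Λ.choose t : ℝ)) := by
  unfold cornerLoad
  refine Finset.sum_subset (Finset.range_mono (by omega)) fun s _ hs => ?_
  rw [Finset.mem_range] at hs
  rw [Nat.choose_eq_zero_of_lt (show Λ < t + s by omega)]
  simp

theorem card_multicast (Λ : ℕ) (K : ℕ → ℕ) {ι : Type} [Fintype ι] (lev : ι → ℕ)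
    (hlev : ∀ a, lev a ≤ Λ) :
    (Fintype.card (Multicast Λ K lev) : ℝ) =
      ∑ a, (Λ.choose (lev a) : ℝ) * cornerLoad Λ K (lev a) := by
  simp only [Fintype.card_sigma, Fintype.card_prod, Fintype.card_fin, Fintype.card_finset_len,
    Nat.cast_sum, Nat.cast_mul, cornerLoad_eq_sum, Finset.sum_range]
  refine Finset.sum_congr rfl fun a _ => ?_
  rw [Finset.mul_sum]
  refine Finset.sum_congr rfl fun s _ => ?_
  have : (Λ.choose (lev a) : ℝ) ≠ 0 := by exact_mod_cast (Nat.choose_pos (hlev a)).ne'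
  field_simp

/-- The coded scheme on the layers `ι`: the cache size and the load are the averages of
`lev a * N / Λ` and `cornerLoad Λ K (lev a)` over the layers, weighted by their sizes. -/
theorem achievable_of_layers {Λ N : ℕ} (K : ℕ → ℕ) {ι : Type} [Fintype ι] (lev : ι → ℕ)
    (hlev : ∀ a, lev a ≤ Λ) (hB : 0 < ∑ a, Λ.choose (lev a)) {M R : ℝ}
    (hM : (N : ℝ) * ∑ a, (lev a : ℝ) * Λ.choose (lev a) ≤
      Λ * (M * ∑ a, (Λ.choose (lev a) : ℝ)))
    (hR : ∑ a, (Λ.choose (lev a) : ℝ) * cornerLoad Λ K (lev a) ≤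
      R * ∑ a, (Λ.choose (lev a) : ℝ)) :
    Achievable (combTopology Λ K) N M R := by
  classical
  have hcard := card_subfile Λ lev
  let e : Fin (∑ a, Λ.choose (lev a)) ≃ Subfile Λ lev :=
    (Fintype.equivFinOfCardEq hcard).symm
  refine ⟨_, hB, fun ℓ => Finset.univ.filter fun p => ℓ ∈ (e p.2).2.1, fun ℓ => ?_, fun d =>
    ⟨Fintype.card (Multicast Λ K lev), ?_, ?_⟩⟩
  · have h1 : (Finset.univ.filter fun p : Fin N × Fin (∑ a, Λ.choose (lev a)) =>
        ℓ ∈ (e p.2).2.1).card = N * Fintype.card {i : Subfile Λ lev // ℓ ∈ i.2.1} := by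
      have h2 : (Finset.univ.filter fun p : Fin N × Fin (∑ a, Λ.choose (lev a)) =>
          ℓ ∈ (e p.2).2.1) = Finset.univ ×ˢ (Finset.univ.filter fun i => ℓ ∈ (e i).2.1) := by
        ext p; simp
      rw [h2, Finset.card_product, Finset.card_univ, Fintype.card_fin, ← Fintype.card_subtype]
      congr 1
      exact Fintype.card_congr (e.subtypeEquiv fun _ => Iff.rfl)
    have hΛ : (0 : ℝ) < Λ := by exact_mod_cast ℓ.pos
    have h3 : ((Fintype.card {i : Subfile Λ lev // ℓ ∈ i.2.1} : ℕ) : ℝ) * Λ =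
        ∑ a, (lev a : ℝ) * Λ.choose (lev a) := by exact_mod_cast card_cached_mul Λ lev ℓ
    rw [h1]
    push_cast
    refine le_of_mul_le_mul_left ?_ hΛ
    calc _ = (N : ℝ) * (((Fintype.card {i : Subfile Λ lev // ℓ ∈ i.2.1} : ℕ) : ℝ) * Λ) := by
          ring
      _ ≤ _ := by rw [h3]; exact hM
  · rw [card_multicast Λ K lev hlev]
    push_cast
    exact hR
  · refine deliverable_of_separates (fun W => multicast d fun n i => W n (e.symm i)) ?_
    intro u W W' henc hc
    have h := multicast_separates d _ _ u henc fun ℓ hℓ n i hi =>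
      hc ℓ hℓ (n, e.symm i) (Finset.mem_filter.2 ⟨Finset.mem_univ _, by
        rwa [Equiv.apply_symm_apply]⟩)
    funext x
    simpa using congrFun h (e x)

/-- Memory sharing between the corner points `t` and `t + 1` with the rational weight `p / q`. -/
theorem achievable_rational {Λ N : ℕ} (K : ℕ → ℕ) {t p q : ℕ} (ht : t < Λ) (hpq : p ≤ q)
    (hq : 0 < q) {M : ℝ} (hM : ((t : ℝ) + (p : ℝ) / q) * ((N : ℝ) / Λ) ≤ M) :
    Achievable (combTopology Λ K) N M
      ((1 - (p : ℝ) / q) * cornerLoad Λ K t + (p : ℝ) / q * cornerLoad Λ K (t + 1)) := by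
  have hc1 : 0 < Λ.choose t := Nat.choose_pos ht.le
  have hc2 : 0 < Λ.choose (t + 1) := Nat.choose_pos ht
  have hΛ : (0 : ℝ) < Λ := by exact_mod_cast (Nat.zero_le t).trans_lt ht
  have hq' : (0 : ℝ) < q := by exact_mod_cast hq
  have hc1' : (0 : ℝ) < Λ.choose t := by exact_mod_cast hc1
  have hc2' : (0 : ℝ) < Λ.choose (t + 1) := by exact_mod_cast hc2
  -- A layer of level `r` has `Λ.choose r` bits, so these numbers of layers make the sizes of the
  -- two parts proportional to `q - p` and `p`.
  let lev : Fin ((q - p) * Λ.choose (t + 1)) ⊕ Fin (p * Λ.choose t) → ℕ :=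
    Sum.elim (fun _ => t) (fun _ => t + 1)
  have hsum : ∀ g : ℕ → ℝ, ∑ a, g (lev a) =
      ((q : ℝ) - p) * Λ.choose (t + 1) * g t + p * Λ.choose t * g (t + 1) := by
    intro g
    simp [lev, Fintype.sum_sum_type, Nat.cast_sub hpq]
  have hB : ∑ a, (Λ.choose (lev a) : ℝ) = q * (Λ.choose t * Λ.choose (t + 1)) := by
    rw [hsum fun r => (Λ.choose r : ℝ)]; ring
  refine achievable_of_layers K lev ?_ ?_ ?_ ?_
  · rintro (a | a)
    · exact ht.le
    · exact ht
  · have : (0 : ℝ) < ∑ a, (Λ.choose (lev a) : ℝ) := by rw [hB]; positivity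
    exact_mod_cast this
  · rw [hsum fun r => (r : ℝ) * Λ.choose r, hB]
    have h1 : (N : ℝ) * (t * q + p) ≤ Λ * M * q := by
      calc (N : ℝ) * (t * q + p) = ((t : ℝ) + (p : ℝ) / q) * ((N : ℝ) / Λ) * (Λ * q) := by
            field_simp
        _ ≤ M * (Λ * q) := by gcongr
        _ = _ := by ring
    have h2 := mul_le_mul_of_nonneg_right h1 (mul_pos hc1' hc2').le
    push_cast
    linarith
  · rw [hsum fun r => (Λ.choose r : ℝ) * cornerLoad Λ K r, hB]
    refine le_of_eq ?_
    field_simp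

/-! ### The converse bound for one demand -/

/-- Every cache of `U` has a smaller index than every cache of `T`. -/
def Before {Λ : ℕ} (U T : Finset (Fin Λ)) : Prop := ∀ a ∈ U, ∀ b ∈ T, a < b

instance {Λ : ℕ} (U T : Finset (Fin Λ)) : Decidable (Before U T) := by
  unfold Before; infer_instance

/-- The caches that store bit `i` of file `n`. -/
def cacheSet {Λ N B : ℕ} (Z : Placement Λ N B) (n : Fin N) (i : Fin B) : Finset (Fin Λ) :=
  Finset.univ.filter fun ℓ => (n, i) ∈ Z ℓ

/-- Renaming of the caches in a set. -/
abbrev rename {Λ : ℕ} (π : Equiv.Perm (Fin Λ)) (U : Finset (Fin Λ)) : Finset (Fin Λ) :=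
  π.finsetCongr U

/-- The acyclic index coding bound. Fix an order `π` of the caches and let the users decode in the
order of the last cache they see. The bits requested by a user and stored only in caches after
its last one cannot be read by this user nor by the later ones, hence the broadcast determines all
of them. -/
theorem sum_card_le_of_deliverable {Λ N B L : ℕ} {b : Connectivity Λ} {Z : Placement Λ N B}
    {d : User b → Fin N} (hd : Function.Injective d) (π : Equiv.Perm (Fin Λ))
    (h : Deliverable b Z d L) :
    ∑ u : User b, (Finset.univ.filter fun i : Fin B =>
      Before (rename π u.1) (rename π (cacheSet Z (d u) i))).card ≤ L := by
  classical
  obtain ⟨enc, dec, hdec⟩ := h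
  let P : User b → Fin B → Prop := fun u i =>
    Before (rename π u.1) (rename π (cacheSet Z (d u) i))
  let A := Σ u : User b, {i : Fin B // P u i}
  -- The library whose free bits are given by `x` and whose other bits vanish.
  let lib : (A → Bool) → Library N B := fun x n i =>
    if hn : ∃ u : User b, d u = n ∧ P u i then
      x ⟨hn.choose, i, hn.choose_spec.2⟩ else false
  have lib_apply : ∀ x (u : User b) (i : Fin B) (hi : P u i), lib x (d u) i = x ⟨u, i, hi⟩ := by
    intro x u i hi
    have hn : ∃ v : User b, d v = d u ∧ P v i := ⟨u, rfl, hi⟩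
    have hv : ∀ v : User b, v = u → ∀ hp : P v i, x ⟨v, i, hp⟩ = x ⟨u, i, hi⟩ := by
      rintro v rfl hp; rfl
    simp only [lib, dif_pos hn]
    exact hv _ (hd hn.choose_spec.1) _
  have hinj : Function.Injective fun x : A → Bool => enc (lib x) := by
    intro x y hxy
    let rank : User b → ℕ := fun u => u.1.sup fun a => (π a : ℕ) + 1
    have key : ∀ (r : ℕ) (u : User b), rank u = r → lib x (d u) = lib y (d u) := by
      intro r
      induction r using Nat.strong_induction_on with
      | _ r ih =>
        intro u hu
        rw [← hdec (lib x) u, ← hdec (lib y) u]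
        have hxy' : enc (lib x) = enc (lib y) := hxy
        rw [hxy']
        congr 1
        funext ℓ p
        obtain ⟨ℓ, hℓ⟩ := ℓ
        obtain ⟨⟨n, i⟩, hp⟩ := p
        change lib x n i = lib y n i
        by_cases hn : ∃ v : User b, d v = n ∧ P v i
        · obtain ⟨v, rfl, hv⟩ := hn
          -- `ℓ` stores the bit, so it comes after the last cache seen by `v`.
          have hlt : rank v < (π ℓ : ℕ) + 1 := by
            refine (Finset.sup_lt_iff (Nat.succ_pos _)).2 fun a ha => ?_
            have := hv (π a) (by simpa [rename] using ha) (π ℓ)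
              (by simpa [rename, cacheSet] using hp)
            exact Nat.succ_lt_succ this
          have hle : (π ℓ : ℕ) + 1 ≤ rank u :=
            Finset.le_sup (f := fun a => (π a : ℕ) + 1) hℓ
          rw [ih (rank v) (hu ▸ hlt.trans_le hle) v rfl]
        · simp only [lib, dif_neg hn]
    funext ⟨u, i, hi⟩
    rw [← lib_apply x u i hi, ← lib_apply y u i hi, key _ u rfl]
  have hcard := Fintype.card_le_of_injective _ hinj
  simp only [Fintype.card_fun, Fintype.card_bool, Fintype.card_fin] at hcard
  have h2 := (Nat.pow_le_pow_iff_right one_lt_two).1 hcard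
  refine le_trans (le_of_eq ?_) h2
  simp only [A, Fintype.card_sigma, P, Fintype.card_subtype]

/-! ### Averaging over the demands and over the orders of the caches -/

/-- The number of users all of whose caches come before those in `T`. -/
def usersBefore {Λ : ℕ} (b : Connectivity Λ) (T : Finset (Fin Λ)) : ℕ :=
  ∑ U, if Before U T then b U else 0

/-- Summing the bound for one demand over the cyclic shifts of an injective demand, each user
requests each file once. -/
theorem sum_usersBefore_le {Λ N B : ℕ} {K : ℕ → ℕ} {Z : Placement Λ N B} {X : ℝ}
    (hN : Fintype.card (User (combTopology Λ K)) ≤ N)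
    (h : ∀ d : User (combTopology Λ K) → Fin N, ∃ L : ℕ, (L : ℝ) ≤ X ∧
      Deliverable (combTopology Λ K) Z d L) (π : Equiv.Perm (Fin Λ)) :
    ((∑ n, ∑ i, usersBefore (combTopology Λ K) (rename π (cacheSet Z n i)) : ℕ) : ℝ) ≤ N * X := by
  classical
  rcases Nat.eq_zero_or_pos N with rfl | hpos
  · simp
  have : NeZero N := ⟨hpos.ne'⟩
  let e : User (combTopology Λ K) → Fin N := fun u =>
    Fin.castLE hN ((Fintype.equivFin (User (combTopology Λ K))) u)
  have he : Function.Injective e := fun u v huv =>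
    (Fintype.equivFin _).injective (Fin.castLE_injective hN huv)
  let G : User (combTopology Λ K) → Fin N → ℕ := fun u n =>
    (Finset.univ.filter fun i : Fin B =>
      Before (rename π u.1) (rename π (cacheSet Z n i))).card
  have hc : ∀ c : Fin N, ((∑ u, G u (e u + c) : ℕ) : ℝ) ≤ X := by
    intro c
    obtain ⟨L, hL, hdel⟩ := h fun u => e u + c
    refine le_trans ?_ hL
    exact_mod_cast sum_card_le_of_deliverable
      (fun u v huv => he (add_right_cancel huv)) π hdel
  have h1 : ∑ c : Fin N, ∑ u, G u (e u + c) =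
      ∑ n, ∑ i, usersBefore (combTopology Λ K) (rename π (cacheSet Z n i)) := by
    rw [Finset.sum_comm]
    have h2 : ∀ u, ∑ c, G u (e u + c) = ∑ n, G u n := fun u =>
      Equiv.sum_comp (Equiv.addLeft (e u)) (G u)
    simp only [h2]
    rw [Finset.sum_comm]
    refine Finset.sum_congr rfl fun n _ => ?_
    simp only [G, Finset.card_filter]
    rw [Finset.sum_comm]
    refine Finset.sum_congr rfl fun i _ => ?_
    unfold usersBefore
    rw [← Equiv.sum_comp π.finsetCongr, Fintype.sum_sigma]
    refine Finset.sum_congr rfl fun U _ => ?_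
    change ∑ _k : Fin (combTopology Λ K U),
      (if Before (rename π U) (rename π (cacheSet Z n i)) then 1 else 0) = _
    rw [Finset.sum_const, Finset.card_univ, Fintype.card_fin, smul_eq_mul, mul_ite, mul_one,
      mul_zero]
    simp only [combTopology, Equiv.finsetCongr_apply, Finset.card_map]
    rfl
  rw [← h1]
  push_cast at hc ⊢
  calc _ ≤ ∑ _c : Fin N, X := Finset.sum_le_sum fun c _ => hc c
    _ = N * X := by simp

theorem exists_perm_rename_eq {Λ : ℕ} {T T' : Finset (Fin Λ)} (h : T.card = T'.card) :
    ∃ σ : Equiv.Perm (Fin Λ), rename σ T = T' := by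
  classical
  let e : {x // x ∈ T} ≃ {x // x ∈ T'} := Finset.equivOfCardEq h
  refine ⟨e.extendSubtype, Finset.eq_of_subset_of_card_le ?_ (by simp [rename, h])⟩
  intro x hx
  simp only [rename, Equiv.finsetCongr_apply, Finset.mem_map_equiv] at hx
  have := e.extendSubtype_mem _ hx
  simpa using this

/-- Under a uniformly random permutation, a set of size `t` becomes a uniformly random set of
size `t`. -/
theorem choose_mul_sum_perm {Λ : ℕ} (F : Finset (Fin Λ) → ℕ) (T : Finset (Fin Λ)) :
    Λ.choose T.card * ∑ π : Equiv.Perm (Fin Λ), F (rename π T) =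
      Λ.factorial * ∑ T' ∈ Finset.powersetCard T.card Finset.univ, F T' := by
  classical
  have h1 : ∀ T' ∈ Finset.powersetCard T.card (Finset.univ : Finset (Fin Λ)),
      ∑ π : Equiv.Perm (Fin Λ), F (rename π T') = ∑ π : Equiv.Perm (Fin Λ), F (rename π T) := by
    intro T' hT'
    obtain ⟨σ, rfl⟩ := exists_perm_rename_eq (Finset.mem_powersetCard.1 hT').2.symm
    rw [← Equiv.sum_comp (Equiv.mulRight σ) fun π => F (rename π T)]
    refine Finset.sum_congr rfl fun π _ => ?_
    congr 1
    ext x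
    simp only [rename, Equiv.finsetCongr_apply, Finset.mem_map_equiv]
    rfl
  have h2 := Finset.sum_congr rfl h1
  rw [Finset.sum_const, Finset.card_powersetCard, Finset.card_univ, Fintype.card_fin,
    smul_eq_mul] at h2
  rw [← h2, Finset.sum_comm]
  have h3 : ∀ π : Equiv.Perm (Fin Λ),
      ∑ T' ∈ Finset.powersetCard T.card Finset.univ, F (rename π T') =
      ∑ T' ∈ Finset.powersetCard T.card Finset.univ, F T' := by
    intro π
    refine Finset.sum_equiv π.finsetCongr (fun T' => ?_) fun _ _ => rfl
    simp [Finset.mem_powersetCard]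
  rw [Finset.sum_congr rfl fun π _ => h3 π, Finset.sum_const, Finset.card_univ,
    Fintype.card_perm, Fintype.card_fin, smul_eq_mul]

theorem exists_initial_subset {Λ s : ℕ} {S : Finset (Fin Λ)} (h : s ≤ S.card) :
    ∃ U ⊆ S, U.card = s ∧ Before U (S \ U) := by
  classical
  induction s with
  | zero => exact ⟨∅, by simp, rfl, by simp [Before]⟩
  | succ s ih =>
    obtain ⟨U, hU, hc, hb⟩ := ih (by omega)
    have hne : (S \ U).Nonempty := by
      rw [← Finset.card_pos, Finset.card_sdiff_of_subset hU]; omega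
    have hm := Finset.mem_sdiff.1 ((S \ U).min'_mem hne)
    refine ⟨insert ((S \ U).min' hne) U, Finset.insert_subset hm.1 hU, ?_, ?_⟩
    · rw [Finset.card_insert_of_notMem hm.2, hc]
    · intro a ha c hcm
      simp only [Finset.mem_sdiff, Finset.mem_insert, not_or] at hcm
      have hcS : c ∈ S \ U := Finset.mem_sdiff.2 ⟨hcm.1, hcm.2.2⟩
      rcases Finset.mem_insert.1 ha with rfl | ha
      · exact lt_of_le_of_ne (Finset.min'_le _ _ hcS) (Ne.symm hcm.2.1)
      · exact hb a ha c hcS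

/-- Each set of `t + s` caches splits into its first `s` and its last `t` caches. -/
theorem choose_le_card_before (Λ t s : ℕ) :
    Λ.choose (t + s) ≤ ∑ T ∈ Finset.powersetCard t (Finset.univ : Finset (Fin Λ)),
      ((Finset.powersetCard s Finset.univ).filter fun U => Before U T).card := by
  classical
  rw [← Finset.card_sigma]
  have : Λ.choose (t + s) = (Finset.powersetCard (t + s) (Finset.univ : Finset (Fin Λ))).card := by
    simp
  rw [this]
  refine Finset.card_le_card_of_surjOn (fun x => x.1 ∪ x.2) ?_
  intro S hS
  have hS' : S.card = t + s := by simpa using hS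
  obtain ⟨U, hU, hc, hb⟩ := exists_initial_subset (S := S) (s := s) (by omega)
  refine ⟨⟨S \ U, U⟩, ?_, by simpa using hU⟩
  simp only [Finset.coe_sigma, Set.mem_sigma_iff, Finset.mem_coe, Finset.mem_powersetCard,
    Finset.subset_univ, true_and, Finset.mem_filter]
  exact ⟨by rw [Finset.card_sdiff_of_subset hU]; omega, hc, hb⟩

theorem sum_choose_le_sum_usersBefore (Λ : ℕ) (K : ℕ → ℕ) (t : ℕ) :
    ∑ s ∈ Finset.range (Λ + 1), K s * Λ.choose (t + s) ≤
      ∑ T ∈ Finset.powersetCard t (Finset.univ : Finset (Fin Λ)),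
        usersBefore (combTopology Λ K) T := by
  classical
  have h1 : ∀ T : Finset (Fin Λ), usersBefore (combTopology Λ K) T =
      ∑ s ∈ Finset.range (Λ + 1),
        K s * ((Finset.powersetCard s Finset.univ).filter fun U => Before U T).card := by
    intro T
    unfold usersBefore combTopology
    rw [← Finset.powerset_univ, Finset.sum_powerset]
    simp only [Finset.card_univ, Fintype.card_fin]
    refine Finset.sum_congr rfl fun s _ => ?_
    rw [← Finset.sum_filter, Finset.sum_congr rfl (g := fun _ => K s), Finset.sum_const,
      smul_eq_mul, mul_comm]
    intro U hU
    rw [(Finset.mem_powersetCard.1 (Finset.mem_filter.1 hU).1).2]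
  simp only [h1]
  rw [Finset.sum_comm]
  refine Finset.sum_le_sum fun s _ => ?_
  rw [← Finset.mul_sum]
  exact Nat.mul_le_mul_left _ (choose_le_card_before Λ t s)

/-! ### Convexity of the corner loads -/

theorem choose_ratio_succ {Λ t : ℕ} (s : ℕ) (ht : t < Λ) :
    ((Λ.choose (t + 1 + s) : ℝ) / Λ.choose (t + 1)) * ((Λ - t) * (t + s + 1)) =
      ((Λ.choose (t + s) : ℝ) / Λ.choose t) * ((t + 1) * ((Λ - (t + s) : ℕ) : ℝ)) := by
  have hc1 : (Λ.choose t : ℝ) ≠ 0 := by exact_mod_cast (Nat.choose_pos ht.le).ne'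
  have hc2 : (Λ.choose (t + 1) : ℝ) ≠ 0 := by exact_mod_cast (Nat.choose_pos ht).ne'
  have h1 : (Λ.choose (t + 1) : ℝ) * (t + 1) = Λ.choose t * (Λ - t) := by
    have := Nat.choose_succ_right_eq Λ t
    rw [← Nat.cast_sub ht.le]; exact_mod_cast this
  have h2 : (Λ.choose (t + 1 + s) : ℝ) * (t + s + 1) =
      Λ.choose (t + s) * ((Λ - (t + s) : ℕ) : ℝ) := by
    have := Nat.choose_succ_right_eq Λ (t + s)
    rw [show t + 1 + s = t + s + 1 by omega]; exact_mod_cast this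
  rw [div_mul_eq_mul_div, div_mul_eq_mul_div, div_eq_div_iff hc2 hc1]
  calc _ = ((Λ.choose (t + 1 + s) : ℝ) * (t + s + 1)) * (Λ.choose t * (Λ - t)) := by ring
    _ = _ := by rw [h2, ← h1]; ring

/-- The decrement of `t ↦ Λ.choose (t + s) / Λ.choose t` in closed form. -/
theorem choose_ratio_sub {Λ t s : ℕ} (ht : t < Λ) :
    (Λ.choose (t + s) : ℝ) / Λ.choose t - (Λ.choose (t + 1 + s) : ℝ) / Λ.choose (t + 1) =
      ((Λ.choose (t + s) : ℝ) / Λ.choose t) * (s * (Λ + 1) / ((Λ - t) * (t + s + 1))) := by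
  have h := choose_ratio_succ s ht
  have hpos : (0 : ℝ) < Λ - t := by
    have : (t : ℝ) < Λ := by exact_mod_cast ht
    linarith
  have hpos2 : (0 : ℝ) < t + s + 1 := by positivity
  rw [mul_div_assoc', eq_div_iff (by positivity), sub_mul, h]
  rcases le_or_gt (t + s) Λ with hs | hs
  · rw [Nat.cast_sub hs]; push_cast; ring
  · rw [Nat.choose_eq_zero_of_lt hs]; simp

theorem choose_ratio_antitone {Λ t : ℕ} (s : ℕ) (ht : t < Λ) :
    (Λ.choose (t + 1 + s) : ℝ) / Λ.choose (t + 1) ≤ (Λ.choose (t + s) : ℝ) / Λ.choose t := by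
  rw [← sub_nonneg, choose_ratio_sub ht]
  have hpos : (0 : ℝ) < Λ - t := by
    have : (t : ℝ) < Λ := by exact_mod_cast ht
    linarith
  positivity

theorem choose_ratio_convex {Λ t : ℕ} (s : ℕ) (ht : t + 1 < Λ) :
    (Λ.choose (t + 1 + s) : ℝ) / Λ.choose (t + 1) -
        (Λ.choose (t + 1 + 1 + s) : ℝ) / Λ.choose (t + 1 + 1) ≤
      (Λ.choose (t + s) : ℝ) / Λ.choose t - (Λ.choose (t + 1 + s) : ℝ) / Λ.choose (t + 1) := by
  have htΛ : t < Λ := by omega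
  rw [choose_ratio_sub ht, choose_ratio_sub htΛ]
  rcases Nat.eq_zero_or_pos s with rfl | hs
  · simp
  have h := choose_ratio_succ s htΛ
  set x := (Λ.choose (t + s) : ℝ) / Λ.choose t with hx
  set y := (Λ.choose (t + 1 + s) : ℝ) / Λ.choose (t + 1) with hy
  have hx0 : 0 ≤ x := by positivity
  have hpos : (0 : ℝ) < Λ - (t + 1 : ℕ) := by
    have : ((t + 1 : ℕ) : ℝ) < Λ := by exact_mod_cast ht
    linarith
  have hpos1 : (0 : ℝ) < Λ - t := by push_cast at hpos; linarith
  have hsub : ((Λ - (t + s) : ℕ) : ℝ) ≤ Λ - (t + 1 : ℕ) := by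
    rw [← Nat.cast_sub ht.le]; exact_mod_cast (by omega : Λ - (t + s) ≤ Λ - (t + 1))
  rw [mul_div_assoc', mul_div_assoc', div_le_div_iff₀ (by positivity) (by positivity)]
  calc y * (s * (Λ + 1)) * ((Λ - t) * (t + s + 1))
      = (x * (s * (Λ + 1))) * ((((Λ - (t + s) : ℕ) : ℝ)) * (t + 1)) := by
        linear_combination (s * (Λ + 1) : ℝ) * h
    _ ≤ (x * (s * (Λ + 1))) * ((Λ - (t + 1 : ℕ)) * ((t + 1 : ℕ) + s + 1)) := by
        refine mul_le_mul_of_nonneg_left (mul_le_mul hsub ?_ (by positivity) hpos.le)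
          (by positivity)
        push_cast
        have : (0 : ℝ) ≤ s := by positivity
        linarith

theorem cornerLoad_antitone {Λ t : ℕ} (K : ℕ → ℕ) (ht : t < Λ) :
    cornerLoad Λ K (t + 1) ≤ cornerLoad Λ K t := by
  rw [cornerLoad_eq_sum, cornerLoad_eq_sum]
  exact Finset.sum_le_sum fun s _ =>
    mul_le_mul_of_nonneg_left (choose_ratio_antitone s ht) (Nat.cast_nonneg _)

theorem cornerLoad_convex {Λ t : ℕ} (K : ℕ → ℕ) (ht : t + 1 < Λ) :
    cornerLoad Λ K (t + 1) - cornerLoad Λ K t ≤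
      cornerLoad Λ K (t + 1 + 1) - cornerLoad Λ K (t + 1) := by
  simp only [cornerLoad_eq_sum, ← Finset.sum_sub_distrib, ← mul_sub]
  refine Finset.sum_le_sum fun s _ => mul_le_mul_of_nonneg_left ?_ (Nat.cast_nonneg _)
  have := choose_ratio_convex s ht
  linarith

/-- A finite sequence with nondecreasing increments lies above the line through any two
consecutive points. -/
theorem line_le_of_convex {a : ℕ → ℝ} {n : ℕ}
    (h : ∀ i, i + 1 < n → a (i + 1) - a i ≤ a (i + 1 + 1) - a (i + 1)) {t j : ℕ} (ht : t < n)
    (hj : j ≤ n) : a t + ((j : ℝ) - t) * (a (t + 1) - a t) ≤ a j := by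
  have hmono : ∀ k i, i + k < n → a (i + 1) - a i ≤ a (i + k + 1) - a (i + k) := by
    intro k
    induction k with
    | zero => intro i _; exact le_rfl
    | succ k ih => exact fun i hi => (ih i (by omega)).trans (h (i + k) (by omega))
  rcases le_total t j with htj | htj
  · obtain ⟨k, rfl⟩ := Nat.exists_eq_add_of_le htj
    clear htj
    induction k with
    | zero => simp
    | succ k ih =>
      have h1 := ih (by omega)
      have h2 := hmono k t (by omega)
      rw [← add_assoc]
      push_cast at h1 ⊢
      linarith
  · obtain ⟨k, rfl⟩ := Nat.exists_eq_add_of_le htj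
    clear htj
    induction k generalizing j with
    | zero => simp
    | succ k ih =>
      have h1 := ih (j := j + 1) (by omega) (by omega)
      have h2 := hmono (k + 1) j (by omega)
      rw [show j + 1 + k = j + (k + 1) by omega] at h1
      push_cast at h1 h2 ⊢
      linarith

/-! ### The two bounds on the optimal load -/

/-- Averaged over all orders of the caches, a bit stored in `T.card` caches contributes at least
the corner load of index `T.card`. -/
theorem cornerLoad_le_sum_perm {Λ : ℕ} (K : ℕ → ℕ) (T : Finset (Fin Λ)) :
    (Λ.factorial : ℝ) * cornerLoad Λ K T.card ≤
      ((∑ π : Equiv.Perm (Fin Λ), usersBefore (combTopology Λ K) (rename π T) : ℕ) : ℝ) := by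
  have hT : T.card ≤ Λ := by simpa using Finset.card_le_univ T
  have hc : (0 : ℝ) < Λ.choose T.card := by exact_mod_cast Nat.choose_pos hT
  have h1 := choose_mul_sum_perm (usersBefore (combTopology Λ K)) T
  have h2 := sum_choose_le_sum_usersBefore Λ K T.card
  have h3 := Nat.mul_le_mul_left Λ.factorial h2
  rw [← h1] at h3
  have h4 : cornerLoad Λ K T.card * Λ.choose T.card =
      ((∑ s ∈ Finset.range (Λ + 1), K s * Λ.choose (T.card + s) : ℕ) : ℝ) := by
    rw [cornerLoad_eq_sum, Finset.sum_mul]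
    push_cast
    refine Finset.sum_congr rfl fun s _ => ?_
    field_simp
  refine le_of_mul_le_mul_left ?_ hc
  calc _ = (Λ.factorial : ℝ) * (cornerLoad Λ K T.card * Λ.choose T.card) := by ring
    _ ≤ _ := by rw [h4]; exact_mod_cast h3

theorem sum_card_cacheSet {Λ N B : ℕ} (Z : Placement Λ N B) :
    ∑ n, ∑ i, (cacheSet Z n i).card = ∑ ℓ, (Z ℓ).card := by
  classical
  simp only [cacheSet, Finset.card_filter]
  rw [← Fintype.sum_prod_type' fun n i => ∑ ℓ, if (n, i) ∈ Z ℓ then 1 else 0, Finset.sum_comm]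
  refine Finset.sum_congr rfl fun ℓ _ => ?_
  simp

theorem card_user_combTopology (Λ : ℕ) (K : ℕ → ℕ) :
    Fintype.card (User (combTopology Λ K)) = ∑ s ∈ Finset.range (Λ + 1), K s * Λ.choose s := by
  have := Finset.sum_powerset_apply_card K (x := (Finset.univ : Finset (Fin Λ)))
  simp only [Finset.powerset_univ, Finset.card_univ, Fintype.card_fin, smul_eq_mul] at this
  calc Fintype.card (User (combTopology Λ K)) = ∑ U : Finset (Fin Λ), K U.card := by
        rw [Fintype.card_sigma]
        exact Finset.sum_congr rfl fun U _ => Fintype.card_fin _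
    _ = _ := this.trans (Finset.sum_congr rfl fun s _ => mul_comm _ _)

theorem le_of_achievable {Λ N : ℕ} {K : ℕ → ℕ} {t : ℕ} (ht : t < Λ) {θ R : ℝ}
    (hN : Fintype.card (User (combTopology Λ K)) ≤ N) (hpos : 0 < N)
    (h : Achievable (combTopology Λ K) N (((t : ℝ) + θ) * ((N : ℝ) / Λ)) R) :
    (1 - θ) * cornerLoad Λ K t + θ * cornerLoad Λ K (t + 1) ≤ R := by
  obtain ⟨B, hB, Z, hZ, hd⟩ := h
  have hΛ : (0 : ℝ) < Λ := by exact_mod_cast (Nat.zero_le t).trans_lt ht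
  have hB' : (0 : ℝ) < B := by exact_mod_cast hB
  have hN' : (0 : ℝ) < N := by exact_mod_cast hpos
  have hf : (0 : ℝ) < Λ.factorial := by exact_mod_cast Λ.factorial_pos
  have h1 : ∑ n, ∑ i, cornerLoad Λ K (cacheSet Z n i).card ≤ N * (R * B) := by
    refine le_of_mul_le_mul_left ?_ hf
    calc (Λ.factorial : ℝ) * ∑ n, ∑ i, cornerLoad Λ K (cacheSet Z n i).card
        = ∑ n, ∑ i, (Λ.factorial : ℝ) * cornerLoad Λ K (cacheSet Z n i).card := by
          simp only [Finset.mul_sum]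
      _ ≤ ∑ n, ∑ i, ((∑ π : Equiv.Perm (Fin Λ),
            usersBefore (combTopology Λ K) (rename π (cacheSet Z n i)) : ℕ) : ℝ) :=
          Finset.sum_le_sum fun n _ => Finset.sum_le_sum fun i _ => cornerLoad_le_sum_perm K _
      _ = ∑ π : Equiv.Perm (Fin Λ), ((∑ n, ∑ i,
            usersBefore (combTopology Λ K) (rename π (cacheSet Z n i)) : ℕ) : ℝ) := by
          push_cast
          rw [Finset.sum_comm]
          refine (Finset.sum_congr rfl fun n _ => Finset.sum_comm).trans ?_
          rw [Finset.sum_comm]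
          simp only [Finset.sum_comm (γ := Fin B)]
      _ ≤ ∑ _π : Equiv.Perm (Fin Λ), (N : ℝ) * (R * B) :=
          Finset.sum_le_sum fun π _ => sum_usersBefore_le hN hd π
      _ = _ := by simp [Fintype.card_perm]
  -- The sum of the tangent-line bounds depends on the placement only through its total size.
  have h2 : ∑ n : Fin N, ∑ i : Fin B, (cornerLoad Λ K t +
      (((cacheSet Z n i).card : ℝ) - t) * (cornerLoad Λ K (t + 1) - cornerLoad Λ K t)) ≤
      ∑ n, ∑ i, cornerLoad Λ K (cacheSet Z n i).card :=
    Finset.sum_le_sum fun n _ => Finset.sum_le_sum fun i _ =>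
      line_le_of_convex (fun j hj => cornerLoad_convex K hj) ht
        (by simpa using Finset.card_le_univ (cacheSet Z n i))
  have h3 : ∑ n : Fin N, ∑ i : Fin B, ((cacheSet Z n i).card : ℝ) ≤ (t + θ) * N * B := by
    have h4 : ∑ n : Fin N, ∑ i : Fin B, ((cacheSet Z n i).card : ℝ) =
        ∑ ℓ, ((Z ℓ).card : ℝ) := by exact_mod_cast sum_card_cacheSet Z
    rw [h4]
    calc _ ≤ ∑ _ℓ : Fin Λ, ((t : ℝ) + θ) * ((N : ℝ) / Λ) * B :=
          Finset.sum_le_sum fun ℓ _ => hZ ℓ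
      _ = _ := by simp; field_simp
  have h5 : ∑ n : Fin N, ∑ i : Fin B, (cornerLoad Λ K t +
      (((cacheSet Z n i).card : ℝ) - t) * (cornerLoad Λ K (t + 1) - cornerLoad Λ K t)) =
      N * B * cornerLoad Λ K t + (∑ n : Fin N, ∑ i : Fin B, ((cacheSet Z n i).card : ℝ) -
        t * N * B) * (cornerLoad Λ K (t + 1) - cornerLoad Λ K t) := by
    simp only [Finset.sum_add_distrib, ← Finset.sum_mul, Finset.sum_sub_distrib, Finset.sum_const,
      Finset.card_univ, Fintype.card_fin, nsmul_eq_mul]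
    ring
  have h6 := mul_le_mul_of_nonpos_right h3 (sub_nonpos.2 (cornerLoad_antitone K ht))
  refine le_of_mul_le_mul_left ?_ (mul_pos hN' hB')
  linarith

theorem le_optimalLoad {Λ N : ℕ} {K : ℕ → ℕ} {t : ℕ} (ht : t < Λ) {θ : ℝ} (hθ : 0 ≤ θ)
    (hN : ∑ s ∈ Finset.range (Λ + 1), K s * Λ.choose s ≤ N) :
    (1 - θ) * cornerLoad Λ K t + θ * cornerLoad Λ K (t + 1) ≤
      optimalLoad (combTopology Λ K) N (((t : ℝ) + θ) * ((N : ℝ) / Λ)) := by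
  have hN' := (card_user_combTopology Λ K).trans_le hN
  refine (isGLB_optimalLoad _ N _ (by positivity) hN').2 fun R hR => ?_
  rcases Nat.eq_zero_or_pos N with rfl | hpos
  · -- Without files there are no users, and all loads vanish.
    have hK : ∀ s ∈ Finset.range (Λ + 1), K s = 0 := fun s hs => by
      have h0 := (Finset.sum_eq_zero_iff.1 (Nat.le_zero.1 hN)) s hs
      have hc := Nat.choose_pos (Nat.lt_succ_iff.1 (Finset.mem_range.1 hs))
      exact (Nat.mul_eq_zero.1 h0).resolve_right hc.ne'
    have hf : ∀ r, cornerLoad Λ K r = 0 := fun r => by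
      rw [cornerLoad_eq_sum]
      exact Finset.sum_eq_zero fun s hs => by simp [hK s hs]
    obtain ⟨B, hB, Z, -, hd⟩ := hR
    obtain ⟨L, hL, -⟩ := hd fun u => Fin.castLE hN' (Fintype.equivFin _ u)
    have hB' : (0 : ℝ) < B := by exact_mod_cast hB
    rw [hf, hf]
    simpa using nonneg_of_mul_nonneg_left ((Nat.cast_nonneg L).trans hL) hB'
  · exact le_of_achievable ht hN' hpos hR

/-- The rational memory-sharing points `⌊θ * n⌋ / n` approximate `θ` from below, so that the cache
size suffices for each of them. -/
theorem optimalLoad_le {Λ N : ℕ} {K : ℕ → ℕ} {t : ℕ} (ht : t < Λ) {θ : ℝ} (hθ : 0 ≤ θ)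
    (hθ1 : θ ≤ 1) (hN : ∑ s ∈ Finset.range (Λ + 1), K s * Λ.choose s ≤ N) :
    optimalLoad (combTopology Λ K) N (((t : ℝ) + θ) * ((N : ℝ) / Λ)) ≤
      (1 - θ) * cornerLoad Λ K t + θ * cornerLoad Λ K (t + 1) := by
  have hglb := isGLB_optimalLoad (combTopology Λ K) N (((t : ℝ) + θ) * ((N : ℝ) / Λ))
    (by positivity) ((card_user_combTopology Λ K).trans_le hN)
  have h1 : Tendsto (fun n : ℕ => ((⌊θ * (n : ℝ)⌋₊ : ℕ) : ℝ) / n) atTop (𝓝 θ) :=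
    (tendsto_nat_floor_mul_div_atTop hθ).comp tendsto_natCast_atTop_atTop
  refine ge_of_tendsto (((tendsto_const_nhds.sub h1).mul_const (cornerLoad Λ K t)).add
    (h1.mul_const (cornerLoad Λ K (t + 1)))) ?_
  filter_upwards [eventually_gt_atTop 0] with n hn
  have hn' : (0 : ℝ) < n := by exact_mod_cast hn
  have hfl : ((⌊θ * (n : ℝ)⌋₊ : ℕ) : ℝ) ≤ θ * n := Nat.floor_le (by positivity)
  refine hglb.1 (achievable_rational K ht ?_ hn ?_)
  · have : ((⌊θ * (n : ℝ)⌋₊ : ℕ) : ℝ) ≤ n := hfl.trans (by nlinarith)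
    exact_mod_cast this
  · have : ((⌊θ * (n : ℝ)⌋₊ : ℕ) : ℝ) / n ≤ θ := (div_le_iff₀ hn').2 hfl
    gcongr

end MACC

theorem theorem1 (Λ N : ℕ) (K : ℕ → ℕ) (hΛ : 0 < Λ)
    (hN : ∑ s ∈ Finset.range (Λ + 1), K s * Λ.choose s ≤ N) :
    (∀ t : ℕ, t ≤ Λ →
      MACC.optimalLoad (MACC.combTopology Λ K) N ((t : ℝ) * ((N : ℝ) / (Λ : ℝ))) =
        MACC.cornerLoad Λ K t) ∧
    (∀ t : ℕ, t < Λ → ∀ θ : ℝ, 0 ≤ θ → θ ≤ 1 →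
      MACC.optimalLoad (MACC.combTopology Λ K) N (((t : ℝ) + θ) * ((N : ℝ) / (Λ : ℝ))) =
        (1 - θ) * MACC.cornerLoad Λ K t + θ * MACC.cornerLoad Λ K (t + 1)) := by
  have hseg : ∀ t : ℕ, t < Λ → ∀ θ : ℝ, 0 ≤ θ → θ ≤ 1 →
      MACC.optimalLoad (MACC.combTopology Λ K) N (((t : ℝ) + θ) * ((N : ℝ) / (Λ : ℝ))) =
        (1 - θ) * MACC.cornerLoad Λ K t + θ * MACC.cornerLoad Λ K (t + 1) :=
    fun t ht θ h0 h1 => le_antisymm (MACC.optimalLoad_le ht h0 h1 hN) (MACC.le_optimalLoad ht h0 hN)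
  refine ⟨fun t ht => ?_, hseg⟩
  -- The last corner is the right end of the last segment, the others are left ends.
  rcases ht.lt_or_eq with ht | rfl
  · simpa using hseg t ht 0 le_rfl zero_le_one
  · obtain ⟨r, rfl⟩ := Nat.exists_eq_add_of_lt hΛ
    simpa using hseg r (by omega) 1 zero_le_one le_rfl
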